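/- **Theorem (Randomized frontier equals the concave closure).** Let $\mathcal X,\mathcal Y,\mathcal Z$ be Polish spaces with their Borel $\sigma$-algebras and let $(X,Y,Z)$ be a random triple with law $P$ on $\mathcal X\times\mathcal Y\times\mathcal Z$ such that $H(Z\mid Y)<\infty$ (Shannon entropy) and $I((X,Z);Y)<\infty$. A deterministic predictor is a measurable map $f:\mathcal X\times\mathcal Z\to\mathcal Y$, with output $U=f(X,Z)$. A randomized predictor consists of a noise variable $N$, independent of $(X,Y,Z)$, with an arbitrary law on an arbitrary standard Borel space $\mathcal N$, and a measurable map $f:\mathcal X\times\mathcal Z\times\mathcal N\to\mathcal Y$; its output is $\widetilde U=(N,f(X,Z,N))$. Define $$\mathcal S_{\det}=\{(I(U;Z\mid Y),\,I(U;Y)):U\text{ deterministic}\},\qquad \mathcal S_{\mathrm{rand}}=\{(I(\widetilde U;Z\mid Y),\,I(\widetilde U;Y)):\widetilde U\text{ randomized}\},$$ and for $S\subset\mathbb R^2$ and $v\in\mathbb R$ let $U_S(v)=\sup\{u:(v',u)\in S\text{ for some }v'\le v\}$. Then: 1. All these (conditional) mutual informations are finite, so $\mathcal S_{\det},\mathcal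 S_{\mathrm{rand}}\subset\mathbb R_{\ge0}^2$, and for every $v\ge 0$ the suprema defining $U_S(v)$, for $S=\mathcal S_{\det},\ \mathcal S_{\mathrm{rand}},\ \mathrm{conv}(\mathcal S_{\det}),\ \overline{\mathrm{conv}}(\mathcal S_{\det})$, are over nonempty bounded-above sets. 2. $\mathrm{conv}(\mathcal S_{\det})\subset\mathcal S_{\mathrm{rand}}\subset\overline{\mathrm{conv}}(\mathcal S_{\det})$. 3. $U_{\mathcal S_{\mathrm{rand}}}(v)=U_{\mathrm{conv}(\mathcal S_{\det})}(v)$ for all $v\ge0$, $\;U_{\mathcal S_{\mathrm{rand}}}(v)=U_{\overline{\mathrm{conv}}(\mathcal S_{\det})}(v)$ for all $v>0$, and $U_{\overline{\mathrm{conv}}(\mathcal S_{\det})}(0)=\lim_{v\downarrow0}U_{\mathcal S_{\mathrm{rand}}}(v)$. 4. On $[0,\infty)$ the randomized Pareto frontier $U_{\mathcal S_{\mathrm{rand}}}$ is the concave closure of the deterministic frontier $U_{\mathcal S_{\det}}$, that is, the smallest concave function on $[0,\infty)$ that is pointwise at least $U_{\mathcal S_{\det}}$; in particular it is concave. -/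

import Mathlib

open MeasureTheory ProbabilityTheory InformationTheory Set Filter Topology
open scoped ENNReal

namespace SepFrontier

noncomputable section

section Information

variable {Ω A B C : Type*} [MeasurableSpace Ω] [MeasurableSpace A] [MeasurableSpace B]
  [MeasurableSpace C]

/-- Mutual information `I(U;V)` (in nats) of two random variables on `(Ω, μ)`: the
Kullback-Leibler divergence of their joint law from the product of their laws. -/
def mutualInfo (μ : Measure Ω) (U : Ω → A) (V : Ω → B) : ℝ≥0∞ :=
  klDiv (μ.map fun ω => (U ω, V ω)) ((μ.map U).prod (μ.map V))

/-- Conditional mutual information `I(U;V|W)` (in nats): the Kullback-Leibler divergence of the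
joint law of `(W, U, V)` from `P_W(dw) P_{U|W=w}(du) P_{V|W=w}(dv)`. -/
def condMutualInfo [StandardBorelSpace A] [Nonempty A] [StandardBorelSpace B] [Nonempty B]
    (μ : Measure Ω) [IsFiniteMeasure μ] (U : Ω → A) (V : Ω → B) (W : Ω → C) : ℝ≥0∞ :=
  klDiv (μ.map fun ω => (W ω, U ω, V ω))
    ((μ.map W).compProd (Kernel.prod (condDistrib U W μ) (condDistrib V W μ)))

open Classical in
/-- Shannon entropy (in nats) of a probability law: `∑ -p log p` over the atoms if the law is
carried by a countable set, and `∞` otherwise. -/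
def entropy (ρ : Measure A) : ℝ≥0∞ :=
  if ∃ S : Set A, S.Countable ∧ ρ Sᶜ = 0 then
    ∑' a : A, ENNReal.ofReal (Real.negMulLog (ρ.real {a}))
  else ∞

/-- Conditional Shannon entropy `H(V|W) = ∫ H(P_{V|W=w}) P_W(dw)`. -/
def condEntropy [StandardBorelSpace A] [Nonempty A]
    (μ : Measure Ω) [IsFiniteMeasure μ] (V : Ω → A) (W : Ω → C) : ℝ≥0∞ :=
  ∫⁻ w, entropy (condDistrib V W μ w) ∂(μ.map W)

end Information

section Predictors

variable {𝒳 𝒴 𝒵 : Type*} [MeasurableSpace 𝒳] [MeasurableSpace 𝒴] [MeasurableSpace 𝒵]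

/-- The output `f(X,Z)` of a deterministic predictor, as a random variable on the canonical space
of triples `(X,Y,Z)`. -/
def detOutput (f : 𝒳 × 𝒵 → 𝒴) : 𝒳 × 𝒴 × 𝒵 → 𝒴 :=
  fun ω => f (ω.1, ω.2.2)

/-- The revealed output `(N, f(X,Z,N))` of a randomized predictor, as a random variable on the
canonical space of pairs `((X,Y,Z),N)`. -/
def randOutput {𝒩 : Type*} (f : 𝒳 × 𝒵 × 𝒩 → 𝒴) : (𝒳 × 𝒴 × 𝒵) × 𝒩 → 𝒩 × 𝒴 :=
  fun ω => (ω.2, f (ω.1.1, ω.1.2.2, ω.2))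

/-- `I(f(X,Z);Y)`. -/
def detUtility (P : Measure (𝒳 × 𝒴 × 𝒵)) (f : 𝒳 × 𝒵 → 𝒴) : ℝ≥0∞ :=
  mutualInfo P (detOutput f) (fun ω => ω.2.1)

/-- `I((N, f(X,Z,N));Y)`, where `N` has law `ν` and is independent of `(X,Y,Z)`. -/
def randUtility (P : Measure (𝒳 × 𝒴 × 𝒵)) {𝒩 : Type*} [MeasurableSpace 𝒩] (ν : Measure 𝒩)
    (f : 𝒳 × 𝒵 × 𝒩 → 𝒴) : ℝ≥0∞ :=
  mutualInfo (P.prod ν) (randOutput f) (fun ω => ω.1.2.1)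

variable [StandardBorelSpace 𝒴] [Nonempty 𝒴] [StandardBorelSpace 𝒵] [Nonempty 𝒵]

/-- `I(f(X,Z);Z|Y)`. -/
def detViolation (P : Measure (𝒳 × 𝒴 × 𝒵)) [IsFiniteMeasure P] (f : 𝒳 × 𝒵 → 𝒴) : ℝ≥0∞ :=
  condMutualInfo P (detOutput f) (fun ω => ω.2.2) (fun ω => ω.2.1)

/-- `I((N, f(X,Z,N));Z|Y)`, where `N` has law `ν` and is independent of `(X,Y,Z)`. -/
def randViolation (P : Measure (𝒳 × 𝒴 × 𝒵)) [IsFiniteMeasure P]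
    {𝒩 : Type*} [MeasurableSpace 𝒩] [StandardBorelSpace 𝒩] [Nonempty 𝒩]
    (ν : Measure 𝒩) [IsFiniteMeasure ν] (f : 𝒳 × 𝒵 × 𝒩 → 𝒴) : ℝ≥0∞ :=
  condMutualInfo (P.prod ν) (randOutput f) (fun ω => ω.1.2.2) (fun ω => ω.1.2.1)

/-- The (violation, utility) pairs of all deterministic predictors. -/
def detAttainable (P : Measure (𝒳 × 𝒴 × 𝒵)) [IsFiniteMeasure P] : Set (ℝ × ℝ) :=
  {p | ∃ f : 𝒳 × 𝒵 → 𝒴, Measurable f ∧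
    p = ((detViolation P f).toReal, (detUtility P f).toReal)}

/-- The (violation, utility) pairs of all randomized predictors. The noise may live on any
standard Borel space; each of these is isomorphic to one in `Type`. -/
def randAttainable (P : Measure (𝒳 × 𝒴 × 𝒵)) [IsFiniteMeasure P] : Set (ℝ × ℝ) :=
  {p | ∃ (𝒩 : Type) (_ : MeasurableSpace 𝒩) (_ : StandardBorelSpace 𝒩) (_ : Nonempty 𝒩)
    (ν : Measure 𝒩) (_ : IsProbabilityMeasure ν) (f : 𝒳 × 𝒵 × 𝒩 → 𝒴), Measurable f ∧
    p = ((randViolation P ν f).toReal, (randUtility P ν f).toReal)}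

end Predictors

/-- The utilities available in `S` under the violation budget `v`. -/
def feasibleUtilities (S : Set (ℝ × ℝ)) (v : ℝ) : Set ℝ :=
  {u | ∃ v' ≤ v, (v', u) ∈ S}

/-- The upper (Pareto) frontier of a set of (violation, utility) pairs:
`U_S(v) = sup {u : (v',u) ∈ S, v' ≤ v}`. -/
def upperFrontier (S : Set (ℝ × ℝ)) (v : ℝ) : ℝ :=
  sSup (feasibleUtilities S v)

/-- On `s`, the function `g` is the smallest concave function that is at least `f`. -/
def IsLeastConcaveMajorantOn (s : Set ℝ) (f g : ℝ → ℝ) : Prop :=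
  ConcaveOn ℝ s g ∧ (∀ v ∈ s, f v ≤ g v) ∧
    ∀ h : ℝ → ℝ, ConcaveOn ℝ s h → (∀ v ∈ s, f v ≤ h v) → ∀ v ∈ s, g v ≤ h v

end

end SepFrontier

/-! The noise is independent of `(X,Y,Z)` and is itself revealed, so by the chain rule both
informations of a randomized predictor are averages over `n` of those of the deterministic
predictors `f(·,·,n)`: `randUtility_eq_lintegral` and `randViolation_eq_lintegral`. A randomized
pair is thus the mean of a random point of the deterministic set `D`. Finitely supported noise
realizes every convex combination, and the mean of an integrable random point of `D` lies in the
closed convex hull.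

Each information is written as the divergence between two images, under one map built from the
output, of `P ⊗ₘ k₁` and `P ⊗ₘ k₂`: the kernel `k₁` copies the true variable and `k₂` resamples it
from its law or conditional law. The predictor enters only through the map, so data processing
bounds utility by `I((X,Z);Y)` and violation by `H(Z|Y)`, and `klDiv_prod_compProd_map` averages
both quantities.

The rest is planar convexity. The frontier of a convex set is concave, hence continuous on `(0,∞)`,
and closing the set changes nothing there. At budget `0` a vanishing mean violation forces almost
every slice to have zero violation, so randomization gains nothing. Minimality holds because a
nonnegative concave function on the half-line is monotone and its convex hypograph contains `D`. -/

namespace SepFrontier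

/-! ### Kullback-Leibler divergence of kernels, point masses and products with noise. -/

section KullbackLeibler

variable {α β γ : Type*} [MeasurableSpace α] [MeasurableSpace β] [MeasurableSpace γ]

/-- On an absolutely continuous fibre, the divergence is computed by the kernel density. -/
lemma klDiv_kernel_eq_lintegral [MeasurableSpace.CountableOrCountablyGenerated α β]
    (κ η : Kernel α β) [IsFiniteKernel κ] [IsFiniteKernel η] {a : α} (h : κ a ≪ η a) :
    klDiv (κ a) (η a) = ∫⁻ x, ENNReal.ofReal (klFun (Kernel.rnDeriv κ η a x).toReal) ∂(η a) := by
  rw [klDiv_eq_lintegral_klFun_of_ac h]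
  refine lintegral_congr_ae ?_
  filter_upwards [Kernel.rnDeriv_eq_rnDeriv_measure (κ := κ) (η := η) (a := a)] with x hx
  rw [hx]

lemma measurable_ofReal_klFun_rnDeriv [MeasurableSpace.CountableOrCountablyGenerated α β]
    (κ η : Kernel α β) :
    Measurable fun p : α × β =>
      ENNReal.ofReal (klFun (Kernel.rnDeriv κ η p.1 p.2).toReal) :=
  (measurable_klFun.comp (Kernel.measurable_rnDeriv κ η).ennreal_toReal).ennreal_ofReal

lemma measurable_klDiv_kernel [MeasurableSpace.CountableOrCountablyGenerated α β]
    (κ η : Kernel α β) [IsFiniteKernel κ] [IsFiniteKernel η] :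
    Measurable fun a => klDiv (κ a) (η a) := by
  classical
  have h : (fun a => klDiv (κ a) (η a)) = fun a => if κ a ≪ η a then
      ∫⁻ x, ENNReal.ofReal (klFun (Kernel.rnDeriv κ η a x).toReal) ∂(η a) else ∞ := by
    funext a
    split_ifs with ha
    · exact klDiv_kernel_eq_lintegral κ η ha
    · exact klDiv_of_not_ac ha
  rw [h]
  exact Measurable.ite (Kernel.measurableSet_absolutelyContinuous κ η)
    (measurable_ofReal_klFun_rnDeriv κ η).lintegral_kernel_prod_right measurable_const

/-- Integrating the jointly measurable fibre density recovers `μ ⊗ₘ κ`, and densities are unique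
almost everywhere. -/
lemma rnDeriv_compProd_right [MeasurableSpace.CountableOrCountablyGenerated α β]
    (μ : Measure α) [IsFiniteMeasure μ] (κ η : Kernel α β) [IsFiniteKernel κ] [IsFiniteKernel η]
    (h : ∀ᵐ a ∂μ, κ a ≪ η a) :
    (μ ⊗ₘ κ).rnDeriv (μ ⊗ₘ η) =ᵐ[μ ⊗ₘ η] fun p => Kernel.rnDeriv κ η p.1 p.2 := by
  have hm : Measurable fun p : α × β => Kernel.rnDeriv κ η p.1 p.2 := Kernel.measurable_rnDeriv κ η
  have heq : (μ ⊗ₘ η).withDensity (fun p => Kernel.rnDeriv κ η p.1 p.2) = μ ⊗ₘ κ := by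
    ext s hs
    rw [withDensity_apply _ hs, ← lintegral_indicator hs,
      Measure.lintegral_compProd (hm.indicator hs), Measure.compProd_apply hs]
    refine lintegral_congr_ae ?_
    filter_upwards [h] with a ha
    have hsa : MeasurableSet (Prod.mk a ⁻¹' s) := measurable_prodMk_left hs
    rw [← Kernel.setLIntegral_rnDeriv ha hsa, ← lintegral_indicator hsa]
    rfl
  rw [← heq]
  exact Measure.rnDeriv_withDensity _ hm

/-- The divergence of two composition-products with the same first marginal is the average
divergence of the kernels. -/
theorem klDiv_compProd_right [MeasurableSpace.CountableOrCountablyGenerated α β]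
    (μ : Measure α) [IsFiniteMeasure μ] (κ η : Kernel α β) [IsFiniteKernel κ] [IsFiniteKernel η] :
    klDiv (μ ⊗ₘ κ) (μ ⊗ₘ η) = ∫⁻ a, klDiv (κ a) (η a) ∂μ := by
  by_cases h : ∀ᵐ a ∂μ, κ a ≪ η a
  · rw [klDiv_eq_lintegral_klFun_of_ac (Measure.absolutelyContinuous_compProd_right_iff.2 h)]
    calc _ = ∫⁻ p, ENNReal.ofReal (klFun (Kernel.rnDeriv κ η p.1 p.2).toReal) ∂(μ ⊗ₘ η) := by
          refine lintegral_congr_ae ?_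
          filter_upwards [rnDeriv_compProd_right μ κ η h] with p hp
          rw [hp]
      _ = ∫⁻ a, klDiv (κ a) (η a) ∂μ := by
          rw [Measure.lintegral_compProd (measurable_ofReal_klFun_rnDeriv κ η)]
          refine lintegral_congr_ae ?_
          filter_upwards [h] with a ha
          rw [klDiv_kernel_eq_lintegral κ η ha]
  · rw [klDiv_of_not_ac (fun h' => h (Measure.absolutelyContinuous_compProd_right_iff.1 h'))]
    symm
    -- A finite integral makes almost every fibre divergence finite, which forces fibrewise absolute
    -- continuity.
    by_contra hne
    refine h ?_
    filter_upwards [ae_lt_top (measurable_klDiv_kernel κ η) hne] with a ha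
    by_contra hac
    simp [klDiv_of_not_ac hac] at ha

/-- Data processing applies in both directions. -/
lemma klDiv_map_of_leftInverse (μ ν : Measure α) [IsFiniteMeasure μ] [IsFiniteMeasure ν]
    {f : α → β} {g : β → α} (hf : Measurable f) (hg : Measurable g)
    (h : Function.LeftInverse g f) : klDiv (μ.map f) (ν.map f) = klDiv μ ν := by
  refine le_antisymm (klDiv_map_le μ ν hf) ?_
  have h' := klDiv_map_le (μ.map f) (ν.map f) hg
  simpa [Measure.map_map hg hf, h.comp_eq_id] using h'

lemma klDiv_dirac_left [MeasurableSingletonClass α] (ρ : Measure α) [IsProbabilityMeasure ρ]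
    {z : α} (hz : ρ {z} ≠ 0) :
    klDiv (Measure.dirac z) ρ = ENNReal.ofReal (-Real.log (ρ.real {z})) := by
  have hm : Measurable (({z} : Set α).indicator fun _ : α => (ρ {z})⁻¹) :=
    measurable_const.indicator (measurableSet_singleton z)
  have heq : ρ.withDensity (({z} : Set α).indicator fun _ => (ρ {z})⁻¹) = Measure.dirac z := by
    ext s hs
    rw [withDensity_apply _ hs, lintegral_indicator (measurableSet_singleton z),
      Measure.restrict_restrict (measurableSet_singleton z), lintegral_const,
      Measure.restrict_apply_univ, Measure.dirac_apply' _ hs]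
    by_cases hzs : z ∈ s
    · rw [inter_eq_left.2 (by simpa using hzs), ENNReal.inv_mul_cancel hz (measure_ne_top _ _)]
      simp [hzs]
    · rw [singleton_inter_eq_empty.2 hzs]
      simp [hzs]
  have hac : Measure.dirac z ≪ ρ := heq ▸ withDensity_absolutelyContinuous _ _
  have hrn : (Measure.dirac z).rnDeriv ρ z = (ρ {z})⁻¹ := by
    have h := Measure.rnDeriv_withDensity ρ hm
    rw [heq] at h
    have h' := hac.ae_le h
    simpa using (ae_dirac_iff (measurableSet_eq_fun (Measure.measurable_rnDeriv _ _) hm)).1 h'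
  have hllr : llr (Measure.dirac z) ρ z = -Real.log (ρ.real {z}) := by
    rw [llr, hrn, ENNReal.toReal_inv, Real.log_inv, Measure.real]
  have hint : Integrable (llr (Measure.dirac z) ρ) (Measure.dirac z) :=
    integrable_dirac (by simp)
  rw [klDiv_of_ac_of_integrable hac hint, integral_dirac, hllr]
  simp

/-- The divergence of a point mass from `ρ` is the surprise `-log ρ{z}`, whose mean is the entropy.
This is the source of the bound `I ≤ H`. -/
lemma lintegral_klDiv_dirac_le_entropy [MeasurableSingletonClass α] (ρ : Measure α)
    [IsProbabilityMeasure ρ] :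
    ∫⁻ z, klDiv (Measure.dirac z) ρ ∂ρ ≤ entropy ρ := by
  rw [entropy]
  split_ifs with h
  · obtain ⟨S, hS, hS0⟩ := h
    have hrest : ρ = ρ.restrict S := 
      (Measure.restrict_eq_self_of_ae_mem (by rw [ae_iff]; exact hS0)).symm
    calc ∫⁻ z, klDiv (Measure.dirac z) ρ ∂ρ
        = ∫⁻ z in S, klDiv (Measure.dirac z) ρ ∂ρ := by
          conv_lhs => rw [hrest]
          rw [← hrest]
      _ = ∑' z : S, klDiv (Measure.dirac z.1) ρ * ρ {z.1} := lintegral_countable _ hS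
      _ = ∑' z : S, ENNReal.ofReal (Real.negMulLog (ρ.real {z.1})) := by
          refine tsum_congr fun z => ?_
          by_cases hz : ρ {z.1} = 0
          · simp [hz, Measure.real]
          · rw [klDiv_dirac_left ρ hz, ← ofReal_measureReal (μ := ρ) (s := {z.1}),
              ← ENNReal.ofReal_mul', Real.negMulLog]
            · congr 1; ring
            · exact measureReal_nonneg
      _ ≤ _ := ENNReal.tsum_comp_le_tsum_of_injective Subtype.val_injective _
  · exact le_top

/-- The law of `(N, g(ω, N))` for independent `ω` and `N` disintegrates along the laws of
`g(ω, n)`. -/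
lemma map_prod_eq_compProd (P : Measure α) [SFinite P] (ν : Measure β) [SFinite ν]
    {g : α × β → γ} (hg : Measurable g) :
    (P.prod ν).map (fun p => (p.2, g p)) =
      ν ⊗ₘ ((Kernel.const β P ×ₖ Kernel.id).map g) := by
  ext s hs
  have hm : Measurable fun p : α × β => (p.2, g p) := measurable_snd.prodMk hg
  rw [Measure.map_apply hm hs, Measure.prod_apply_symm (hm hs), Measure.compProd_apply hs]
  refine lintegral_congr fun n => ?_
  have hsn : MeasurableSet (Prod.mk n ⁻¹' s) := measurable_prodMk_left hs
  rw [Kernel.map_apply' _ hg _ hsn, Kernel.prod_apply, Kernel.const_apply, Kernel.id_apply,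
    Measure.prod_apply_symm (hg hsn), lintegral_dirac']
  · rfl
  · exact measurable_measure_prodMk_right (hg hsn)

lemma kernel_const_prod_id_map_apply (P : Measure α) [SFinite P] {g : α × β → γ}
    (hg : Measurable g) (n : β) :
    ((Kernel.const β P ×ₖ Kernel.id).map g) n = P.map fun ω => g (ω, n) := by
  ext s hs
  rw [Kernel.map_apply' _ hg _ hs, Kernel.prod_apply, Kernel.const_apply, Kernel.id_apply,
    Measure.prod_apply_symm (hg hs), lintegral_dirac']
  · exact (Measure.map_apply (hg.comp measurable_prodMk_right) hs).symm
  · exact measurable_measure_prodMk_right (hg hs)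

variable (P Q : Measure α) [IsProbabilityMeasure P] [IsProbabilityMeasure Q]

lemma measurable_klDiv_map [StandardBorelSpace γ] {g : α × β → γ} (hg : Measurable g) :
    Measurable fun n => klDiv (P.map fun ω => g (ω, n)) (Q.map fun ω => g (ω, n)) := by
  simp_rw [← kernel_const_prod_id_map_apply P hg, ← kernel_const_prod_id_map_apply Q hg]
  have := Kernel.IsMarkovKernel.map (Kernel.const β P ×ₖ Kernel.id) hg
  have := Kernel.IsMarkovKernel.map (Kernel.const β Q ×ₖ Kernel.id) hg
  exact measurable_klDiv_kernel _ _

/-- Revealed independent noise averages the divergence. -/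
theorem klDiv_map_prod [StandardBorelSpace γ] (ν : Measure β) [IsFiniteMeasure ν]
    {g : α × β → γ} (hg : Measurable g) :
    klDiv ((P.prod ν).map fun p => (p.2, g p)) ((Q.prod ν).map fun p => (p.2, g p)) =
      ∫⁻ n, klDiv (P.map fun ω => g (ω, n)) (Q.map fun ω => g (ω, n)) ∂ν := by
  have := Kernel.IsMarkovKernel.map (Kernel.const β P ×ₖ Kernel.id) hg
  have := Kernel.IsMarkovKernel.map (Kernel.const β Q ×ₖ Kernel.id) hg
  rw [map_prod_eq_compProd P ν hg, map_prod_eq_compProd Q ν hg, klDiv_compProd_right]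
  simp_rw [kernel_const_prod_id_map_apply P hg, kernel_const_prod_id_map_apply Q hg]

end KullbackLeibler

/-! ### Informations as divergences between a copied and a resampled variable. -/

section Randomization

variable {Ω A B C E F N : Type*} [MeasurableSpace Ω] [MeasurableSpace A] [MeasurableSpace B]
  [MeasurableSpace C] [MeasurableSpace E] [MeasurableSpace F] [MeasurableSpace N]

lemma compProd_deterministic_map (μ : Measure Ω) [SFinite μ] {V : Ω → B} (hV : Measurable V)
    {g : Ω × B → C} (hg : Measurable g) :
    (μ ⊗ₘ Kernel.deterministic V hV).map g = μ.map fun ω => g (ω, V ω) := by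
  have hm : Measurable fun ω => (ω, V ω) := measurable_id.prodMk hV
  rw [Measure.compProd_deterministic, Measure.map_map hg hm]
  rfl

lemma map_comp_fst_prod (P : Measure Ω) [SFinite P] (ν : Measure N) [IsProbabilityMeasure ν]
    {V : Ω → B} (hV : Measurable V) :
    (P.prod ν).map (fun ω => V ω.1) = P.map V := by
  have h := Measure.map_map (μ := P.prod ν) hV measurable_fst
  rw [← Measure.fst, Measure.fst_prod] at h
  exact h.symm

lemma mutualInfo_eq_klDiv_map (μ : Measure Ω) [IsFiniteMeasure μ] {U : Ω → A} {V : Ω → B}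
    (hU : Measurable U) (hV : Measurable V) :
    mutualInfo μ U V = klDiv ((μ ⊗ₘ Kernel.deterministic V hV).map fun p => (U p.1, p.2))
      ((μ ⊗ₘ Kernel.const Ω (μ.map V)).map fun p => (U p.1, p.2)) := by
  rw [mutualInfo, compProd_deterministic_map μ hV (by fun_prop), Measure.compProd_const]
  congr 1
  have h := Measure.map_prod_map μ (μ.map V) hU measurable_id
  rw [Measure.map_id] at h
  exact h

lemma condMutualInfo_eq_klDiv_map [StandardBorelSpace A] [Nonempty A] [StandardBorelSpace B]
    [Nonempty B] (μ : Measure Ω) [IsFiniteMeasure μ] {U : Ω → A} {V : Ω → B} {W : Ω → C}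
    (hU : Measurable U) (hV : Measurable V) (hW : Measurable W) :
    condMutualInfo μ U V W =
      klDiv ((μ ⊗ₘ Kernel.deterministic V hV).map fun p => (W p.1, U p.1, p.2))
        ((μ ⊗ₘ (condDistrib V W μ).comap W hW).map fun p => (W p.1, U p.1, p.2)) := by
  have hg : Measurable fun p : Ω × B => (W p.1, U p.1, p.2) := by fun_prop
  rw [condMutualInfo, compProd_deterministic_map μ hV hg]
  congr 1
  ext s hs
  have hs' : MeasurableSet {q : (C × A) × B | (q.1.1, q.1.2, q.2) ∈ s} :=
    (by fun_prop : Measurable fun q : (C × A) × B => (q.1.1, q.1.2, q.2)) hs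
  have hF : Measurable fun q : C × A => condDistrib V W μ q.1 {v | (q.1, q.2, v) ∈ s} :=
    Kernel.measurable_kernel_prodMk_left (κ := (condDistrib V W μ).prodMkRight A) hs'
  -- Given `W`, the resampled `V` does not depend on `U`, so the conditional law of `U` recombines
  -- with the law of `W` into the joint law of `(W, U)`.
  calc _ = ∫⁻ w, ∫⁻ u, condDistrib V W μ w {v | (w, u, v) ∈ s} ∂(condDistrib U W μ w)
            ∂(μ.map W) := by
        rw [Measure.compProd_apply hs]
        refine lintegral_congr fun w => ?_
        rw [Kernel.prod_apply, Measure.prod_apply (measurable_prodMk_left hs)]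
        rfl
    _ = ∫⁻ q, condDistrib V W μ q.1 {v | (q.1, q.2, v) ∈ s} ∂(μ.map fun ω => (W ω, U ω)) := by
        rw [← compProd_map_condDistrib hU.aemeasurable, Measure.lintegral_compProd hF]
    _ = _ := by
        rw [lintegral_map hF (hW.prodMk hU), Measure.map_apply hg hs,
          Measure.compProd_apply (hg hs)]
        rfl

/-- The kernel ignores the noise, so the noise stays independent of the extended pair. -/
lemma prod_compProd_comap_fst_map_rightComm (P : Measure Ω) [IsFiniteMeasure P] (ν : Measure N)
    [IsFiniteMeasure ν] (k : Kernel Ω E) [IsFiniteKernel k] :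
    ((P.prod ν) ⊗ₘ k.comap Prod.fst measurable_fst).map (fun p => ((p.1.1, p.2), p.1.2)) =
      (P ⊗ₘ k).prod ν := by
  symm
  refine Measure.prod_eq fun s t hs ht => ?_
  have hm : Measurable fun p : (Ω × N) × E => ((p.1.1, p.2), p.1.2) := by fun_prop
  have hF : Measurable fun ω => k ω (Prod.mk ω ⁻¹' s) := Kernel.measurable_kernel_prodMk_left hs
  rw [Measure.map_apply hm (hs.prod ht), Measure.compProd_apply (hm (hs.prod ht)),
    Measure.compProd_apply hs, ← lintegral_indicator_one ht,
    ← lintegral_prod_mul hF.aemeasurable (measurable_one.indicator ht).aemeasurable]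
  refine lintegral_congr fun q => ?_
  by_cases hq : q.2 ∈ t
  · simp only [Kernel.comap_apply, hq, indicator_of_mem, Pi.one_apply, mul_one]
    congr 1
    ext e
    simp [hq]
  · simp only [hq, not_false_eq_true, indicator_of_notMem, mul_zero]
    have hempty : Prod.mk q ⁻¹' ((fun p : (Ω × N) × E => ((p.1.1, p.2), p.1.2)) ⁻¹' s ×ˢ t) = ∅ :=
      eq_empty_of_forall_notMem fun e he => hq he.2
    rw [hempty, measure_empty]

/-- Revealed independent noise averages the divergence between two extensions of the base law. -/
theorem klDiv_prod_compProd_map [StandardBorelSpace F] (P : Measure Ω) [IsProbabilityMeasure P]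
    (ν : Measure N) [IsProbabilityMeasure ν] (k₁ k₂ : Kernel Ω E) [IsMarkovKernel k₁]
    [IsMarkovKernel k₂] {g : (Ω × E) × N → F} (hg : Measurable g) :
    klDiv (((P.prod ν) ⊗ₘ k₁.comap Prod.fst measurable_fst).map
        fun p => (p.1.2, g ((p.1.1, p.2), p.1.2)))
      (((P.prod ν) ⊗ₘ k₂.comap Prod.fst measurable_fst).map
        fun p => (p.1.2, g ((p.1.1, p.2), p.1.2))) =
      ∫⁻ n, klDiv ((P ⊗ₘ k₁).map fun q => g (q, n)) ((P ⊗ₘ k₂).map fun q => g (q, n)) ∂ν := by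
  have hm : Measurable fun p : (Ω × N) × E => ((p.1.1, p.2), p.1.2) := by fun_prop
  have hg' : Measurable fun q : (Ω × E) × N => (q.2, g q) := measurable_snd.prodMk hg
  rw [← klDiv_map_prod _ _ ν hg, ← prod_compProd_comap_fst_map_rightComm P ν k₁,
    ← prod_compProd_comap_fst_map_rightComm P ν k₂, Measure.map_map hg' hm, Measure.map_map hg' hm]
  rfl

end Randomization

/-! ### Bounds for deterministic predictors and averaging over the noise. -/

section Predictors

variable {𝒳 𝒴 𝒵 𝒩 : Type*} [MeasurableSpace 𝒳] [MeasurableSpace 𝒴] [MeasurableSpace 𝒵]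
  [MeasurableSpace 𝒩]

lemma measurable_detOutput {f : 𝒳 × 𝒵 → 𝒴} (hf : Measurable f) :
    Measurable (detOutput f) := by
  unfold detOutput; fun_prop

lemma measurable_randOutput {f : 𝒳 × 𝒵 × 𝒩 → 𝒴} (hf : Measurable f) :
    Measurable (randOutput f) := by
  unfold randOutput; fun_prop

lemma measurable_slice {f : 𝒳 × 𝒵 × 𝒩 → 𝒴} (hf : Measurable f) (n : 𝒩) :
    Measurable fun p : 𝒳 × 𝒵 => f (p.1, p.2, n) := by
  fun_prop

variable (P : Measure (𝒳 × 𝒴 × 𝒵)) [IsProbabilityMeasure P]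

lemma detUtility_le_mutualInfo {f : 𝒳 × 𝒵 → 𝒴} (hf : Measurable f) :
    detUtility P f ≤ mutualInfo P (fun ω => (ω.1, ω.2.2)) (fun ω => ω.2.1) := by
  have hXZ : Measurable fun ω : 𝒳 × 𝒴 × 𝒵 => (ω.1, ω.2.2) := by fun_prop
  have hY : Measurable fun ω : 𝒳 × 𝒴 × 𝒵 => ω.2.1 := by fun_prop
  have hg : Measurable (Prod.map f (id : 𝒴 → 𝒴)) := hf.prodMap measurable_id
  have h := klDiv_map_le (P.map fun ω => ((ω.1, ω.2.2), ω.2.1))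
    ((P.map fun ω => (ω.1, ω.2.2)).prod (P.map fun ω => ω.2.1)) hg
  rw [← Measure.map_prod_map _ _ hf measurable_id, Measure.map_id, Measure.map_map hf hXZ,
    Measure.map_map hg (hXZ.prodMk hY)] at h
  exact h

section Utility

variable [StandardBorelSpace 𝒴]

lemma measurable_detUtility_slice {f : 𝒳 × 𝒵 × 𝒩 → 𝒴} (hf : Measurable f) :
    Measurable fun n => detUtility P fun p => f (p.1, p.2, n) := by
  have hY : Measurable fun ω : 𝒳 × 𝒴 × 𝒵 => ω.2.1 := by fun_prop
  have := Measure.isProbabilityMeasure_map (μ := P) hY.aemeasurable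
  simp_rw [detUtility, mutualInfo_eq_klDiv_map P (measurable_detOutput (measurable_slice hf _)) hY]
  exact measurable_klDiv_map (P ⊗ₘ Kernel.deterministic _ hY) (P ⊗ₘ Kernel.const _ (P.map _))
    (g := fun q : ((𝒳 × 𝒴 × 𝒵) × 𝒴) × 𝒩 => (f (q.1.1.1, q.1.1.2.2, q.2), q.1.2)) (by fun_prop)

lemma randUtility_eq_lintegral (ν : Measure 𝒩) [IsProbabilityMeasure ν] {f : 𝒳 × 𝒵 × 𝒩 → 𝒴}
    (hf : Measurable f) :
    randUtility P ν f = ∫⁻ n, detUtility P (fun p => f (p.1, p.2, n)) ∂ν := by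
  have hY : Measurable fun ω : 𝒳 × 𝒴 × 𝒵 => ω.2.1 := by fun_prop
  have hY' : Measurable fun ω : (𝒳 × 𝒴 × 𝒵) × 𝒩 => ω.1.2.1 := by fun_prop
  have := Measure.isProbabilityMeasure_map (μ := P) hY.aemeasurable
  simp_rw [detUtility, mutualInfo_eq_klDiv_map P (measurable_detOutput (measurable_slice hf _)) hY]
  have hg : Measurable fun q : ((𝒳 × 𝒴 × 𝒵) × 𝒴) × 𝒩 =>
    (f (q.1.1.1, q.1.1.2.2, q.2), q.1.2) := by fun_prop
  have hlaw : (P.prod ν).map (fun ω => ω.1.2.1) = P.map fun ω => ω.2.1 :=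
    map_comp_fst_prod P ν hY
  refine Eq.trans ?_ (klDiv_prod_compProd_map P ν (Kernel.deterministic _ hY)
    (Kernel.const _ (P.map fun ω => ω.2.1)) hg)
  have hout : Measurable fun p : ((𝒳 × 𝒴 × 𝒵) × 𝒩) × 𝒴 => (randOutput f p.1, p.2) :=
    (measurable_randOutput hf).comp measurable_fst |>.prodMk measurable_snd
  have he : Measurable fun q : (𝒩 × 𝒴) × 𝒴 => (q.1.1, q.1.2, q.2) := by fun_prop
  rw [randUtility, mutualInfo_eq_klDiv_map _ (measurable_randOutput hf) hY', hlaw,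
    -- Reassociating the triple puts the noise in front, at no cost in divergence.
    ← klDiv_map_of_leftInverse _ _ he
      (g := fun q : 𝒩 × 𝒴 × 𝒴 => ((q.1, q.2.1), q.2.2)) (by fun_prop) (fun q => rfl),
    Measure.map_map he hout, Measure.map_map he hout]
  rfl

end Utility

variable [StandardBorelSpace 𝒴] [Nonempty 𝒴] [StandardBorelSpace 𝒵] [Nonempty 𝒵]

/-- Forgetting the output map can only increase the divergence. What remains compares the true `Z`
with its conditional law given `Y`, and the mean surprise is at most the conditional entropy. -/
lemma detViolation_le_condEntropy {f : 𝒳 × 𝒵 → 𝒴} (hf : Measurable f) :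
    detViolation P f ≤ condEntropy P (fun ω => ω.2.2) (fun ω => ω.2.1) := by
  have hY : Measurable fun ω : 𝒳 × 𝒴 × 𝒵 => ω.2.1 := by fun_prop
  have hZ : Measurable fun ω : 𝒳 × 𝒴 × 𝒵 => ω.2.2 := by fun_prop
  set k := condDistrib (fun ω : 𝒳 × 𝒴 × 𝒵 => ω.2.2) (fun ω => ω.2.1) P with hk
  have hF : Measurable fun q : 𝒴 × 𝒵 => klDiv (Measure.dirac q.2) (k q.1) :=
    measurable_klDiv_kernel (Kernel.deterministic Prod.snd measurable_snd)
      (k.comap Prod.fst measurable_fst)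
  have hout := measurable_detOutput (𝒴 := 𝒴) hf
  rw [detViolation, condMutualInfo_eq_klDiv_map P hout hZ hY]
  calc _ ≤ klDiv (P ⊗ₘ Kernel.deterministic _ hZ) (P ⊗ₘ k.comap _ hY) :=
        klDiv_map_le _ _ (by fun_prop)
    _ = ∫⁻ ω, klDiv (Measure.dirac ω.2.2) (k ω.2.1) ∂P := klDiv_compProd_right _ _ _
    _ = ∫⁻ q, klDiv (Measure.dirac q.2) (k q.1) ∂(P.map fun ω => (ω.2.1, ω.2.2)) :=
        (lintegral_map hF (hY.prodMk hZ)).symm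
    _ = ∫⁻ y, ∫⁻ z, klDiv (Measure.dirac z) (k y) ∂(k y) ∂(P.map fun ω => ω.2.1) := by
        rw [← compProd_map_condDistrib hZ.aemeasurable, Measure.lintegral_compProd hF]
    _ ≤ _ := lintegral_mono fun y => lintegral_klDiv_dirac_le_entropy (k y)

/-- This supplies a point of zero violation, so every feasible set with nonnegative budget is
nonempty. -/
lemma detViolation_const (y : 𝒴) : detViolation P (fun _ : 𝒳 × 𝒵 => y) = 0 := by
  have hY : Measurable fun ω : 𝒳 × 𝒴 × 𝒵 => ω.2.1 := by fun_prop
  have hZ : Measurable fun ω : 𝒳 × 𝒴 × 𝒵 => ω.2.2 := by fun_prop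
  have hg : Measurable fun p : 𝒴 × 𝒵 => (p.1, y, p.2) := by fun_prop
  rw [detViolation, condMutualInfo_eq_klDiv_map P (measurable_detOutput measurable_const) hZ hY,
    ← klDiv_self ((P.map fun ω => (ω.2.1, ω.2.2)).map fun p => (p.1, y, p.2))]
  congr 1
  · rw [compProd_deterministic_map P hZ (by unfold detOutput; fun_prop),
      Measure.map_map hg (hY.prodMk hZ)]
    rfl
  · rw [← compProd_map_condDistrib hZ.aemeasurable]
    ext s hs
    have hs' := hg hs
    have hk : Measurable fun w => condDistrib (fun ω : 𝒳 × 𝒴 × 𝒵 => ω.2.2) (fun ω => ω.2.1) P w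
        (Prod.mk w ⁻¹' ((fun p : 𝒴 × 𝒵 => (p.1, y, p.2)) ⁻¹' s)) :=
      Kernel.measurable_kernel_prodMk_left hs'
    rw [Measure.map_apply hg hs, Measure.compProd_apply hs', lintegral_map hk hY,
      Measure.map_apply (by unfold detOutput; fun_prop) hs,
      Measure.compProd_apply ((by unfold detOutput; fun_prop : Measurable
        fun p : (𝒳 × 𝒴 × 𝒵) × 𝒵 => (p.1.2.1, detOutput (fun _ => y) p.1, p.2)) hs)]
    rfl

lemma measurable_detViolation_slice {f : 𝒳 × 𝒵 × 𝒩 → 𝒴} (hf : Measurable f) :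
    Measurable fun n => detViolation P fun p => f (p.1, p.2, n) := by
  have hY : Measurable fun ω : 𝒳 × 𝒴 × 𝒵 => ω.2.1 := by fun_prop
  have hZ : Measurable fun ω : 𝒳 × 𝒴 × 𝒵 => ω.2.2 := by fun_prop
  simp_rw [detViolation,
    condMutualInfo_eq_klDiv_map P (measurable_detOutput (measurable_slice hf _)) hZ hY]
  exact measurable_klDiv_map (P ⊗ₘ Kernel.deterministic _ hZ)
    (P ⊗ₘ (condDistrib (fun ω : 𝒳 × 𝒴 × 𝒵 => ω.2.2) (fun ω => ω.2.1) P).comap _ hY)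
    (g := fun q : ((𝒳 × 𝒴 × 𝒵) × 𝒵) × 𝒩 =>
      (q.1.1.2.1, f (q.1.1.1, q.1.1.2.2, q.2), q.1.2)) (by fun_prop)

lemma randViolation_eq_lintegral [StandardBorelSpace 𝒩] [Nonempty 𝒩] (ν : Measure 𝒩)
    [IsProbabilityMeasure ν] {f : 𝒳 × 𝒵 × 𝒩 → 𝒴} (hf : Measurable f) :
    randViolation P ν f = ∫⁻ n, detViolation P (fun p => f (p.1, p.2, n)) ∂ν := by
  have hY : Measurable fun ω : 𝒳 × 𝒴 × 𝒵 => ω.2.1 := by fun_prop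
  have hZ : Measurable fun ω : 𝒳 × 𝒴 × 𝒵 => ω.2.2 := by fun_prop
  have hY' : Measurable fun ω : (𝒳 × 𝒴 × 𝒵) × 𝒩 => ω.1.2.1 := by fun_prop
  have hZ' : Measurable fun ω : (𝒳 × 𝒴 × 𝒵) × 𝒩 => ω.1.2.2 := by fun_prop
  simp_rw [detViolation,
    condMutualInfo_eq_klDiv_map P (measurable_detOutput (measurable_slice hf _)) hZ hY]
  set k := condDistrib (fun ω : 𝒳 × 𝒴 × 𝒵 => ω.2.2) (fun ω => ω.2.1) P with hk
  have hg : Measurable fun q : ((𝒳 × 𝒴 × 𝒵) × 𝒵) × 𝒩 =>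
    (q.1.1.2.1, f (q.1.1.1, q.1.1.2.2, q.2), q.1.2) := by fun_prop
  have hlaw : (P.prod ν).map (fun ω => ω.1.2.1) = P.map fun ω => ω.2.1 :=
    map_comp_fst_prod P ν hY
  -- Independent noise leaves the conditional law of `Z` given `Y` unchanged almost everywhere.
  have hcd : (P.prod ν) ⊗ₘ (condDistrib (fun ω : (𝒳 × 𝒴 × 𝒵) × 𝒩 => ω.1.2.2)
      (fun ω => ω.1.2.1) (P.prod ν)).comap _ hY' =
      (P.prod ν) ⊗ₘ (k.comap _ hY).comap Prod.fst measurable_fst := by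
    refine Measure.compProd_congr ?_
    have h := condDistrib_fst_prod (mβ := ‹MeasurableSpace 𝒴›) (μ := P) (Y := fun ω : 𝒳 × 𝒴 × 𝒵 => ω.2.2)
      (fun ω : 𝒳 × 𝒴 × 𝒵 => ω.2.1) hZ.aemeasurable ν
    rw [← hlaw] at h
    filter_upwards [ae_of_ae_map hY'.aemeasurable h] with ω hω
    simpa [Kernel.comap_apply] using hω
  refine Eq.trans ?_ (klDiv_prod_compProd_map P ν (Kernel.deterministic _ hZ) (k.comap _ hY) hg)
  have hout : Measurable fun p : ((𝒳 × 𝒴 × 𝒵) × 𝒩) × 𝒵 =>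
      (p.1.1.2.1, randOutput f p.1, p.2) :=
    hY'.comp measurable_fst |>.prodMk
      (((measurable_randOutput hf).comp measurable_fst).prodMk measurable_snd)
  have he : Measurable fun q : 𝒴 × (𝒩 × 𝒴) × 𝒵 => (q.2.1.1, q.1, q.2.1.2, q.2.2) := by fun_prop
  rw [randViolation, condMutualInfo_eq_klDiv_map _ (measurable_randOutput hf) hZ' hY', hcd,
    ← klDiv_map_of_leftInverse _ _ he
      (g := fun q : 𝒩 × 𝒴 × 𝒴 × 𝒵 => (q.2.1, (q.1, q.2.2.1), q.2.2.2)) (by fun_prop)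
      (fun q => rfl),
    Measure.map_map he hout, Measure.map_map he hout]
  rfl

end Predictors

/-! ### Frontiers of planar sets: concavity, closure, behaviour at zero, minimality. -/

section Frontier

variable {S T : Set (ℝ × ℝ)} {v w B : ℝ}

lemma feasibleUtilities_mono (hST : S ⊆ T) (hvw : v ≤ w) :
    feasibleUtilities S v ⊆ feasibleUtilities T w :=
  fun _ ⟨v', hv', h⟩ => ⟨v', hv'.trans hvw, hST h⟩

lemma bddAbove_feasibleUtilities (hS : ∀ p ∈ S, p.2 ≤ B) (v : ℝ) :
    BddAbove (feasibleUtilities S v) :=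
  ⟨B, fun _ ⟨_, _, h⟩ => hS _ h⟩

lemma feasibleUtilities_nonempty {u : ℝ} (hu : (0, u) ∈ S) (hv : 0 ≤ v) :
    (feasibleUtilities S v).Nonempty :=
  ⟨u, 0, hv, hu⟩

lemma upperFrontier_mono (hST : S ⊆ T) (hvw : v ≤ w) (hT : ∀ p ∈ T, p.2 ≤ B)
    (hne : (feasibleUtilities S v).Nonempty) : upperFrontier S v ≤ upperFrontier T w :=
  csSup_le_csSup (bddAbove_feasibleUtilities hT w) hne (feasibleUtilities_mono hST hvw)

lemma le_upperFrontier (hS : ∀ p ∈ S, p.2 ≤ B) {p : ℝ × ℝ} (hp : p ∈ S) (hv : p.1 ≤ v) :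
    p.2 ≤ upperFrontier S v :=
  le_csSup (bddAbove_feasibleUtilities hS v) ⟨p.1, hv, hp⟩

lemma concaveOn_upperFrontier (hconv : Convex ℝ S) (hS : ∀ p ∈ S, p.2 ≤ B) {u₀ : ℝ}
    (hu₀ : (0, u₀) ∈ S) : ConcaveOn ℝ (Ici 0) (upperFrontier S) := by
  refine ⟨convex_Ici 0, fun x hx y hy a b ha hb hab => ?_⟩
  have hnx := feasibleUtilities_nonempty hu₀ (mem_Ici.1 hx)
  have hny := feasibleUtilities_nonempty hu₀ (mem_Ici.1 hy)
  have key : ∀ u ∈ feasibleUtilities S x, ∀ u' ∈ feasibleUtilities S y,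
      a * u + b * u' ≤ upperFrontier S (a • x + b • y) := by
    rintro u ⟨r, hr, hu⟩ u' ⟨r', hr', hu'⟩
    have h := hconv hu hu' ha hb hab
    refine le_upperFrontier hS h ?_
    simp only [Prod.fst_add, Prod.smul_fst, smul_eq_mul]
    gcongr
  have h1 : ∀ u ∈ feasibleUtilities S x,
      a * u + b * upperFrontier S y ≤ upperFrontier S (a • x + b • y) := by
    intro u hu
    have : b * upperFrontier S y ≤ upperFrontier S (a • x + b • y) - a * u := by
      rw [upperFrontier, ← smul_eq_mul, ← Real.sSup_smul_of_nonneg hb]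
      refine csSup_le (hny.smul_set) ?_
      rintro _ ⟨u', hu', rfl⟩
      have := key u hu u' hu'
      simp only [smul_eq_mul] at this ⊢
      linarith
    linarith
  have : a * upperFrontier S x ≤ upperFrontier S (a • x + b • y) - b * upperFrontier S y := by
    conv_lhs => rw [upperFrontier, ← smul_eq_mul, ← Real.sSup_smul_of_nonneg ha]
    refine csSup_le (hnx.smul_set) ?_
    rintro _ ⟨u, hu, rfl⟩
    have := h1 u hu
    simp only [smul_eq_mul] at this ⊢
    linarith
  simp only [smul_eq_mul] at this ⊢
  linarith

lemma upperFrontier_closure_le (hconv : Convex ℝ S) (hS : ∀ p ∈ S, p.2 ≤ B) {u₀ : ℝ}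
    (hu₀ : (0, u₀) ∈ S) (hv : 0 < v) :
    upperFrontier (closure S) v ≤ upperFrontier S v := by
  refine csSup_le (feasibleUtilities_nonempty (subset_closure hu₀) hv.le) ?_
  rintro u ⟨v', hv', hu⟩
  obtain ⟨p, hpS, hp⟩ := mem_closure_iff_seq_limit.1 hu
  have hcont : ContinuousAt (upperFrontier S) v := by
    have h := (concaveOn_upperFrontier hconv hS hu₀).continuousOn_interior
    rw [interior_Ici] at h
    exact h.continuousAt (Ioi_mem_nhds hv)
  -- An approximating point may exceed the budget `v`; the enlarged budget admits it and still tends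
  -- to `v`, where the frontier is continuous.
  have hmax : Tendsto (fun k => max (p k).1 v) atTop (𝓝 v) := by
    have h := ((continuous_fst.tendsto _).comp hp).max (tendsto_const_nhds (x := v))
    simpa [hv'] using h
  exact le_of_tendsto_of_tendsto' ((continuous_snd.tendsto _).comp hp) (hcont.tendsto.comp hmax)
    fun k => le_upperFrontier hS (hpS k) (le_max_left _ _)

lemma tendsto_upperFrontier_zero (hclosed : IsClosed S) (hS0 : ∀ p ∈ S, 0 ≤ p.1)
    (hS : ∀ p ∈ S, p.2 ≤ B) {u₀ : ℝ} (hu₀ : (0, u₀) ∈ S) :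
    Tendsto (upperFrontier S) (𝓝[>] 0) (𝓝 (upperFrontier S 0)) := by
  refine tendsto_order.2 ⟨fun a ha => ?_, fun a ha => ?_⟩
  · filter_upwards [self_mem_nhdsWithin] with v hv
    exact ha.trans_le (upperFrontier_mono subset_rfl (mem_Ioi.1 hv).le hS
      (feasibleUtilities_nonempty hu₀ le_rfl))
  · obtain ⟨c, hc, hca⟩ := exists_between ha
    -- Points with utility at least `c > U_S(0)` and violation in `[0,1]` form a compact set. Its
    -- violations avoid `0`, hence a neighbourhood of `0`.
    have hK : IsCompact (Prod.fst '' (S ∩ Icc ((0 : ℝ), c) (1, B))) :=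
      (isCompact_Icc.inter_left hclosed).image continuous_fst
    have h0 : (0 : ℝ) ∉ Prod.fst '' (S ∩ Icc ((0 : ℝ), c) (1, B)) := by
      rintro ⟨p, ⟨hpS, hp⟩, hp0⟩
      exact absurd (le_upperFrontier hS hpS hp0.le) (not_le.2 (hc.trans_le hp.1.2))
    have hev : ∀ᶠ v in 𝓝 (0 : ℝ), v ∉ Prod.fst '' (S ∩ Icc ((0 : ℝ), c) (1, B)) :=
      hK.isClosed.isOpen_compl.mem_nhds h0
    obtain ⟨ε, hε, hball⟩ := Metric.eventually_nhds_iff.1 hev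
    have hδ : 0 < min ε 1 := lt_min hε one_pos
    filter_upwards [Ioo_mem_nhdsGT hδ] with v hv
    refine (csSup_le (feasibleUtilities_nonempty hu₀ hv.1.le) ?_).trans_lt hca
    rintro u ⟨v', hv', hu⟩
    by_contra hcu
    have hv0 := hS0 _ hu
    have hvε : v' < min ε 1 := hv'.trans_lt hv.2
    refine hball (y := v') ?_ ⟨_, ⟨hu, ⟨hv0, (not_le.1 hcu).le⟩,
      (hvε.trans_le (min_le_right _ _)).le, hS _ hu⟩, rfl⟩
    rw [Real.dist_eq, sub_zero, abs_of_nonneg hv0]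
    exact hvε.trans_le (min_le_left _ _)

lemma monotoneOn_of_concaveOn_of_nonneg {h : ℝ → ℝ} (hh : ConcaveOn ℝ (Ici 0) h)
    (h0 : ∀ v ∈ Ici (0 : ℝ), 0 ≤ h v) : MonotoneOn h (Ici 0) := by
  intro x hx y hy hxy
  by_contra! hlt
  have hxy' : x < y := hxy.lt_of_ne (by rintro rfl; exact lt_irrefl _ hlt)
  set d := h x - h y with hd
  have hd0 : 0 < d := sub_pos.2 hlt
  -- Chosen so that the chord from `x` through `y`, extended by `t` times its length, falls to
  -- height `h y - d * t = -1`; concavity puts `h` below it.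
  set t := (h y + 1) / d with ht
  have hy0 := h0 y hy
  have ht0 : 0 < t := by positivity
  have hyz : y < y + t * (y - x) := by
    have := mul_pos ht0 (sub_pos.2 hxy'); linarith
  have hz : y + t * (y - x) ∈ Ici (0 : ℝ) := (mem_Ici.1 hy).trans hyz.le
  have hs := hh.slope_anti_adjacent hx hz hxy' hyz
  rw [div_le_div_iff₀ (by linarith) (by linarith)] at hs
  have hz0 := h0 _ hz
  have hyx : 0 < y - x := sub_pos.2 hxy'
  have h1 : (h (y + t * (y - x)) - h y) * (y - x) ≤ (-d * t) * (y - x) := by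
    calc _ ≤ (h y - h x) * (y + t * (y - x) - y) := hs
      _ = _ := by rw [hd]; ring
  have h2 := le_of_mul_le_mul_right h1 hyx
  have h3 : d * t = h y + 1 := by rw [ht]; field_simp
  linarith

lemma upperFrontier_convexHull_le (hS0 : ∀ p ∈ S, 0 ≤ p.1) (hS1 : ∀ p ∈ S, 0 ≤ p.2)
    (hS : ∀ p ∈ S, p.2 ≤ B) {u₀ : ℝ} (hu₀ : (0, u₀) ∈ S) {h : ℝ → ℝ}
    (hh : ConcaveOn ℝ (Ici 0) h) (hle : ∀ v ∈ Ici (0 : ℝ), upperFrontier S v ≤ h v) :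
    ∀ v ∈ Ici (0 : ℝ), upperFrontier (convexHull ℝ S) v ≤ h v := by
  have hmono := monotoneOn_of_concaveOn_of_nonneg hh fun v hv =>
    (hS1 _ hu₀).trans ((le_upperFrontier hS hu₀ hv).trans (hle v hv))
  have hsub : convexHull ℝ S ⊆ {p : ℝ × ℝ | p.1 ∈ Ici (0 : ℝ) ∧ p.2 ≤ h p.1} :=
    convexHull_min (fun p hp =>
      ⟨hS0 p hp, (le_upperFrontier hS hp le_rfl).trans (hle _ (hS0 p hp))⟩) hh.convex_hypograph
  intro v hv
  refine csSup_le (feasibleUtilities_nonempty (subset_convexHull ℝ S hu₀) hv) ?_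
  rintro u ⟨v', hv', hu⟩
  exact (hsub hu).2.trans (hmono (hsub hu).1 hv hv')

end Frontier

/-! ### Attainable pairs as means of deterministic pairs. -/

section Attainable

lemma lintegral_ne_top_of_le_const {α : Type*} [MeasurableSpace α] (ν : Measure α)
    [IsProbabilityMeasure ν] {F : α → ℝ≥0∞} {c : ℝ≥0∞} (hc : c ≠ ∞) (hF : ∀ a, F a ≤ c) :
    ∫⁻ a, F a ∂ν ≠ ∞ := by
  refine ne_top_of_le_ne_top hc ((lintegral_mono hF).trans ?_)
  simp

variable {𝒳 𝒴 𝒵 : Type*} [MeasurableSpace 𝒳] [MeasurableSpace 𝒴] [MeasurableSpace 𝒵]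
  {P : Measure (𝒳 × 𝒴 × 𝒵)} [IsProbabilityMeasure P]

lemma detUtility_ne_top (hI : mutualInfo P (fun ω => (ω.1, ω.2.2)) (fun ω => ω.2.1) ≠ ∞)
    {f : 𝒳 × 𝒵 → 𝒴} (hf : Measurable f) : detUtility P f ≠ ∞ :=
  ne_top_of_le_ne_top hI (detUtility_le_mutualInfo P hf)

section Noise

variable [StandardBorelSpace 𝒴] {𝒩 : Type*} [MeasurableSpace 𝒩] (ν : Measure 𝒩) [IsProbabilityMeasure ν]
  {f : 𝒳 × 𝒵 × 𝒩 → 𝒴}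

lemma randUtility_ne_top (hI : mutualInfo P (fun ω => (ω.1, ω.2.2)) (fun ω => ω.2.1) ≠ ∞)
    (hf : Measurable f) : randUtility P ν f ≠ ∞ := by
  rw [randUtility_eq_lintegral P ν hf]
  exact lintegral_ne_top_of_le_const ν hI fun n =>
    detUtility_le_mutualInfo P (measurable_slice hf n)

lemma integrable_detUtility_slice
    (hI : mutualInfo P (fun ω => (ω.1, ω.2.2)) (fun ω => ω.2.1) ≠ ∞) (hf : Measurable f) :
    Integrable (fun n => (detUtility P fun p => f (p.1, p.2, n)).toReal) ν :=
  integrable_toReal_of_lintegral_ne_top (measurable_detUtility_slice P hf).aemeasurable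
    (randUtility_eq_lintegral P ν hf ▸ randUtility_ne_top ν hI hf)

lemma toReal_randUtility (hI : mutualInfo P (fun ω => (ω.1, ω.2.2)) (fun ω => ω.2.1) ≠ ∞)
    (hf : Measurable f) :
    (randUtility P ν f).toReal = ∫ n, (detUtility P fun p => f (p.1, p.2, n)).toReal ∂ν := by
  rw [randUtility_eq_lintegral P ν hf,
    integral_toReal (measurable_detUtility_slice P hf).aemeasurable]
  exact ae_of_all _ fun n => (detUtility_ne_top hI (measurable_slice hf n)).lt_top

end Noise

variable [StandardBorelSpace 𝒴] [Nonempty 𝒴] [StandardBorelSpace 𝒵] [Nonempty 𝒵]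

lemma detViolation_ne_top (hH : condEntropy P (fun ω => ω.2.2) (fun ω => ω.2.1) ≠ ∞)
    {f : 𝒳 × 𝒵 → 𝒴} (hf : Measurable f) : detViolation P f ≠ ∞ :=
  ne_top_of_le_ne_top hH (detViolation_le_condEntropy P hf)

section Noise

variable {𝒩 : Type*} [MeasurableSpace 𝒩] (ν : Measure 𝒩) [IsProbabilityMeasure ν]
  {f : 𝒳 × 𝒵 × 𝒩 → 𝒴}

lemma lintegral_detViolation_slice_ne_top
    (hH : condEntropy P (fun ω => ω.2.2) (fun ω => ω.2.1) ≠ ∞) (hf : Measurable f) :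
    ∫⁻ n, detViolation P (fun p => f (p.1, p.2, n)) ∂ν ≠ ∞ :=
  lintegral_ne_top_of_le_const ν hH fun n => detViolation_le_condEntropy P (measurable_slice hf n)

lemma integrable_detViolation_slice
    (hH : condEntropy P (fun ω => ω.2.2) (fun ω => ω.2.1) ≠ ∞) (hf : Measurable f) :
    Integrable (fun n => (detViolation P fun p => f (p.1, p.2, n)).toReal) ν :=
  integrable_toReal_of_lintegral_ne_top (measurable_detViolation_slice P hf).aemeasurable
    (lintegral_detViolation_slice_ne_top ν hH hf)

variable [StandardBorelSpace 𝒩] [Nonempty 𝒩]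

lemma randViolation_ne_top (hH : condEntropy P (fun ω => ω.2.2) (fun ω => ω.2.1) ≠ ∞)
    (hf : Measurable f) : randViolation P ν f ≠ ∞ := by
  rw [randViolation_eq_lintegral P ν hf]
  exact lintegral_detViolation_slice_ne_top ν hH hf

lemma toReal_randViolation (hH : condEntropy P (fun ω => ω.2.2) (fun ω => ω.2.1) ≠ ∞)
    (hf : Measurable f) :
    (randViolation P ν f).toReal = ∫ n, (detViolation P fun p => f (p.1, p.2, n)).toReal ∂ν := by
  rw [randViolation_eq_lintegral P ν hf,
    integral_toReal (measurable_detViolation_slice P hf).aemeasurable]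
  exact ae_of_all _ fun n => (detViolation_ne_top hH (measurable_slice hf n)).lt_top

end Noise

variable (P) in
lemma exists_zero_mem_detAttainable : ∃ u, ((0 : ℝ), u) ∈ detAttainable P := by
  obtain ⟨y⟩ := ‹Nonempty 𝒴›
  exact ⟨_, fun _ => y, measurable_const, by rw [detViolation_const]; rfl⟩

lemma snd_le_of_mem_detAttainable
    (hI : mutualInfo P (fun ω => (ω.1, ω.2.2)) (fun ω => ω.2.1) ≠ ∞) :
    ∀ p ∈ detAttainable P, p.2 ≤ (mutualInfo P (fun ω => (ω.1, ω.2.2)) (fun ω => ω.2.1)).toReal := by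
  rintro _ ⟨f, hf, rfl⟩
  exact ENNReal.toReal_mono hI (detUtility_le_mutualInfo P hf)

lemma convexHull_detAttainable_subset
    (hH : condEntropy P (fun ω => ω.2.2) (fun ω => ω.2.1) ≠ ∞)
    (hI : mutualInfo P (fun ω => (ω.1, ω.2.2)) (fun ω => ω.2.1) ≠ ∞) :
    convexHull ℝ (detAttainable P) ⊆ randAttainable P := by
  intro p hp
  obtain ⟨ι, _, w, z, hw0, hw1, hz, rfl⟩ := mem_convexHull_iff_exists_fintype.1 hp
  choose f hf hzf using hz
  let _ : MeasurableSpace ι := ⊤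
  have hne : Nonempty ι := by
    by_contra h
    rw [not_nonempty_iff] at h
    simp at hw1
  -- The noise draws the index of a predictor with the weights of the convex combination.
  set ν : Measure ι := ∑ i, ENNReal.ofReal (w i) • Measure.dirac i with hν
  have hprob : IsProbabilityMeasure ν := by
    refine ⟨?_⟩
    simp [hν, Measure.finsetSum_apply, ← ENNReal.ofReal_sum_of_nonneg (fun i _ => hw0 i), hw1]
  have hmeas : Measurable fun q : 𝒳 × 𝒵 × ι => f q.2.2 (q.1, q.2.1) := by
    have : Measurable fun q : (𝒳 × 𝒵) × ι => f q.2 q.1 := measurable_from_prod_countable_left hf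
    exact this.comp (by fun_prop : Measurable fun q : 𝒳 × 𝒵 × ι => ((q.1, q.2.1), q.2.2))
  have hint : ∀ F : ι → ℝ, ∫ i, F i ∂ν = ∑ i, w i * F i := by
    intro F
    rw [hν, integral_finsetSum_measure fun i _ =>
      (integrable_dirac (by simp)).smul_measure ENNReal.ofReal_ne_top]
    refine Finset.sum_congr rfl fun i _ => ?_
    rw [integral_smul_measure, integral_dirac, ENNReal.toReal_ofReal (hw0 i), smul_eq_mul]
  refine ⟨ι, inferInstance, inferInstance, hne, ν, hprob, _, hmeas, ?_⟩
  rw [toReal_randViolation ν hH hmeas, toReal_randUtility ν hI hmeas, hint, hint]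
  ext <;> simp [Prod.fst_sum, Prod.snd_sum, hzf]

lemma randAttainable_subset
    (hH : condEntropy P (fun ω => ω.2.2) (fun ω => ω.2.1) ≠ ∞)
    (hI : mutualInfo P (fun ω => (ω.1, ω.2.2)) (fun ω => ω.2.1) ≠ ∞) :
    randAttainable P ⊆ closure (convexHull ℝ (detAttainable P)) := by
  rintro _ ⟨𝒩, _, _, _, ν, _, f, hf, rfl⟩
  have hV := integrable_detViolation_slice ν hH hf
  have hU := integrable_detUtility_slice ν hI hf
  rw [toReal_randViolation ν hH hf, toReal_randUtility ν hI hf, ← integral_pair hV hU]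
  exact (convex_convexHull ℝ _).closure.integral_mem isClosed_closure
    (ae_of_all _ fun n => subset_closure (subset_convexHull ℝ _ ⟨_, measurable_slice hf n, rfl⟩))
    (hV.prodMk hU)

/-- Budget `0` needs its own argument, since continuity of the concave frontier is available only in
the interior. A nonnegative violation with zero integral vanishes almost everywhere, so almost every
slice is feasible at budget `0`. -/
lemma snd_le_of_mem_randAttainable_of_fst_nonpos
    (hH : condEntropy P (fun ω => ω.2.2) (fun ω => ω.2.1) ≠ ∞)
    (hI : mutualInfo P (fun ω => (ω.1, ω.2.2)) (fun ω => ω.2.1) ≠ ∞) :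
    ∀ p ∈ randAttainable P, p.1 ≤ 0 → p.2 ≤ upperFrontier (detAttainable P) 0 := by
  rintro _ ⟨𝒩, _, _, _, ν, _, f, hf, rfl⟩ h0
  have hV := integrable_detViolation_slice ν hH hf
  have hU := integrable_detUtility_slice ν hI hf
  rw [toReal_randViolation ν hH hf] at h0
  rw [toReal_randUtility ν hI hf]
  have hnn : 0 ≤ fun n => (detViolation P fun p => f (p.1, p.2, n)).toReal :=
    fun n => ENNReal.toReal_nonneg
  have hae := (integral_eq_zero_iff_of_nonneg hnn hV).1 (h0.antisymm (integral_nonneg hnn))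
  calc _ ≤ ∫ _, upperFrontier (detAttainable P) 0 ∂ν := by
        refine integral_mono_ae hU (integrable_const _) ?_
        filter_upwards [hae] with n hn
        exact le_upperFrontier (snd_le_of_mem_detAttainable hI)
          (p := (_, _)) ⟨_, measurable_slice hf n, rfl⟩ hn.le
    _ = _ := by simp

end Attainable

end SepFrontier

/-! ### Assembly of the theorem. -/

open SepFrontier in
theorem mainTheorem1
    {𝒳 𝒴 𝒵 : Type*}
    [TopologicalSpace 𝒳] [PolishSpace 𝒳] [MeasurableSpace 𝒳] [BorelSpace 𝒳]
    [TopologicalSpace 𝒴] [PolishSpace 𝒴] [MeasurableSpace 𝒴] [BorelSpace 𝒴] [Nonempty 𝒴]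
    [TopologicalSpace 𝒵] [PolishSpace 𝒵] [MeasurableSpace 𝒵] [BorelSpace 𝒵] [Nonempty 𝒵]
    (P : Measure (𝒳 × 𝒴 × 𝒵)) [IsProbabilityMeasure P]
    (hH : condEntropy P (fun ω => ω.2.2) (fun ω => ω.2.1) ≠ ∞)
    (hI : mutualInfo P (fun ω => (ω.1, ω.2.2)) (fun ω => ω.2.1) ≠ ∞) :
    -- all informations are finite
    (∀ f : 𝒳 × 𝒵 → 𝒴, Measurable f → detViolation P f ≠ ∞ ∧ detUtility P f ≠ ∞) ∧
    (∀ (𝒩 : Type) [MeasurableSpace 𝒩] [StandardBorelSpace 𝒩] [Nonempty 𝒩]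
      (ν : Measure 𝒩) [IsProbabilityMeasure ν] (f : 𝒳 × 𝒵 × 𝒩 → 𝒴), Measurable f →
      randViolation P ν f ≠ ∞ ∧ randUtility P ν f ≠ ∞) ∧
    -- the sandwich
    convexHull ℝ (detAttainable P) ⊆ randAttainable P ∧
    randAttainable P ⊆ closure (convexHull ℝ (detAttainable P)) ∧
    -- the suprema that define the frontiers are over nonempty bounded sets
    (∀ v : ℝ, 0 ≤ v → (feasibleUtilities (detAttainable P) v).Nonempty ∧
      BddAbove (feasibleUtilities (closure (convexHull ℝ (detAttainable P))) v)) ∧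
    -- the randomized frontier is the frontier of the convex hull, and of its closure
    (∀ v : ℝ, 0 ≤ v → upperFrontier (randAttainable P) v =
      upperFrontier (convexHull ℝ (detAttainable P)) v) ∧
    (∀ v : ℝ, 0 < v → upperFrontier (randAttainable P) v =
      upperFrontier (closure (convexHull ℝ (detAttainable P))) v) ∧
    Tendsto (upperFrontier (randAttainable P)) (𝓝[>] 0)
      (𝓝 (upperFrontier (closure (convexHull ℝ (detAttainable P))) 0)) ∧
    -- it is the concave closure of the deterministic frontier, hence concave
    IsLeastConcaveMajorantOn (Ici 0)
      (upperFrontier (detAttainable P)) (upperFrontier (randAttainable P)) ∧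
    ConcaveOn ℝ (Ici 0) (upperFrontier (randAttainable P)) := by
  set D := detAttainable P with hD
  obtain ⟨u₀, hu₀⟩ := exists_zero_mem_detAttainable P
  set B := (mutualInfo P (fun ω => (ω.1, ω.2.2)) (fun ω => ω.2.1)).toReal with hB
  have hDB : ∀ p ∈ D, p.2 ≤ B := snd_le_of_mem_detAttainable hI
  have hD0 : ∀ p ∈ D, 0 ≤ p.1 := by
    rintro _ ⟨f, hf, rfl⟩
    exact ENNReal.toReal_nonneg
  have hD1 : ∀ p ∈ D, 0 ≤ p.2 := by
    rintro _ ⟨f, hf, rfl⟩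
    exact ENNReal.toReal_nonneg
  have hCR : convexHull ℝ D ⊆ randAttainable P := convexHull_detAttainable_subset hH hI
  have hRC : randAttainable P ⊆ closure (convexHull ℝ D) := randAttainable_subset hH hI
  -- Both bounds are closed half-planes, so they pass from `D` to its closed convex hull.
  have hcl : closure (convexHull ℝ D) ⊆ {p | 0 ≤ p.1} ∩ {p | p.2 ≤ B} := by
    refine closure_minimal (convexHull_min (fun p hp => ⟨hD0 p hp, hDB p hp⟩) ?_) ?_
    · exact (convex_halfSpace_ge (LinearMap.fst ℝ ℝ ℝ).isLinear 0).inter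
        (convex_halfSpace_le (LinearMap.snd ℝ ℝ ℝ).isLinear B)
    · exact (isClosed_le continuous_const continuous_fst).inter
        (isClosed_le continuous_snd continuous_const)
  have hClB : ∀ p ∈ closure (convexHull ℝ D), p.2 ≤ B := fun p hp => (hcl hp).2
  have hRB : ∀ p ∈ randAttainable P, p.2 ≤ B := fun p hp => hClB p (hRC hp)
  have hCB : ∀ p ∈ convexHull ℝ D, p.2 ≤ B := fun p hp => hRB p (hCR hp)
  have hu₀C : (0, u₀) ∈ convexHull ℝ D := subset_convexHull ℝ D hu₀
  have hclle : ∀ v : ℝ, 0 < v →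
      upperFrontier (closure (convexHull ℝ D)) v ≤ upperFrontier (convexHull ℝ D) v :=
    fun v hv => upperFrontier_closure_le (convex_convexHull ℝ D) hCB hu₀C hv
  have hCle : ∀ v : ℝ, 0 ≤ v → upperFrontier (convexHull ℝ D) v ≤
      upperFrontier (randAttainable P) v := fun v hv =>
    upperFrontier_mono hCR le_rfl hRB (feasibleUtilities_nonempty hu₀C hv)
  have hRle : ∀ v : ℝ, 0 ≤ v → upperFrontier (randAttainable P) v ≤
      upperFrontier (closure (convexHull ℝ D)) v := fun v hv =>
    upperFrontier_mono hRC le_rfl hClB (feasibleUtilities_nonempty (hCR hu₀C) hv)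
  have hRC_eq : ∀ v : ℝ, 0 ≤ v → upperFrontier (randAttainable P) v =
      upperFrontier (convexHull ℝ D) v := by
    intro v hv
    refine le_antisymm ?_ (hCle v hv)
    rcases hv.eq_or_lt with rfl | hv'
    · refine csSup_le (feasibleUtilities_nonempty (hCR hu₀C) le_rfl) ?_
      rintro u ⟨v', hv', hu⟩
      exact (snd_le_of_mem_randAttainable_of_fst_nonpos hH hI _ hu hv').trans
        (upperFrontier_mono (subset_convexHull ℝ D) le_rfl hCB
          (feasibleUtilities_nonempty hu₀ le_rfl))
    · exact (hRle v hv).trans (hclle v hv')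
  have hRcl_eq : ∀ v : ℝ, 0 < v → upperFrontier (randAttainable P) v =
      upperFrontier (closure (convexHull ℝ D)) v := fun v hv =>
    le_antisymm (hRle v hv.le) ((hclle v hv).trans (hCle v hv.le))
  have hconc : ConcaveOn ℝ (Ici 0) (upperFrontier (randAttainable P)) :=
    (concaveOn_upperFrontier (convex_convexHull ℝ D) hCB hu₀C).congr
      fun v hv => (hRC_eq v hv).symm
  refine ⟨fun f hf => ⟨detViolation_ne_top hH hf, detUtility_ne_top hI hf⟩,
    fun 𝒩 _ _ _ ν _ f hf => ⟨randViolation_ne_top ν hH hf, randUtility_ne_top ν hI hf⟩,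
    hCR, hRC, fun v hv => ⟨feasibleUtilities_nonempty hu₀ hv, bddAbove_feasibleUtilities hClB v⟩,
    hRC_eq, hRcl_eq, ?_, ⟨hconc, fun v hv => ?_, fun h hh hle v hv => ?_⟩, hconc⟩
  · refine (tendsto_upperFrontier_zero isClosed_closure (fun p hp => (hcl hp).1) hClB
      (subset_closure hu₀C)).congr' ?_
    filter_upwards [self_mem_nhdsWithin] with v hv
    exact (hRcl_eq v hv).symm
  · exact upperFrontier_mono ((subset_convexHull ℝ D).trans hCR) le_rfl hRB
      (feasibleUtilities_nonempty hu₀ hv)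
  · rw [hRC_eq v hv]
    exact upperFrontier_convexHull_le hD0 hD1 hDB hu₀ hh hle v hv
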